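/- A real-time deterministic push-down automaton (DPDA) is a tuple $M=(Q,\Sigma,\Gamma,\delta,\bot)$ with a finite non-empty set $Q$ of states, finite input and stack alphabets $\Sigma$ and $\Gamma$, a total transition function $\delta\colon Q\times\Sigma\times\Gamma\to Q\times\Gamma^*$ (in particular, there are no $\varepsilon$-transitions), and a stack bottom symbol $\bot\in\Gamma$ such that, whenever $\delta(q,\sigma,x)=(q',\gamma)$ and $\bot$ occurs in $\gamma$, it occurs only as the first letter of $\gamma$ and $x=\bot$. A configuration is a pair in $Q\times\Gamma^*$, the right end of the word being the top of the stack. For $\sigma\in\Sigma$, $\upsilon\in\Gamma^*$ and $x\in\Gamma$ we write $(q,\upsilon x)\xrightarrow{\sigma}(q',\upsilon\gamma)$ if $\delta(q,\sigma,x)=(q',\gamma)$ (a configuration with stack content $\varepsilon$ has no successor); for words $w\in\Sigma^*$, $\xrightarrow{w}$ is the corresponding composition. A word $w\in\Sigma^*$ synchronizes $M$ * in the empty stack model if there is $\overline q\in Q$ with $(q,\bot)\xrightarrow{w}(\overline q,\bot)$ for all $q\in Q$; * in the same stack model if there are $\overline q\in Q$ and $\upsilon\in\Gamma^*$ with $(q,\bot)\xrightarrow{w}(\overline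 q,\upsilon)$ for all $q\in Q$; * in the arbitrary stack model if there is $\overline q\in Q$ such that for every $q\in Q$ there is $\upsilon\in\Gamma^*$ with $(q,\bot)\xrightarrow{w}(\overline q,\upsilon)$. The problems Sync-DPDA-Empty, Sync-DPDA-Same and Sync-DPDA-Arb ask, given a DPDA $M$, whether there is a word $w\in\Sigma^*$ that synchronizes $M$ in the empty, the same, and the arbitrary stack model, respectively. **Corollary.** Each of the three problems Sync-DPDA-Empty, Sync-DPDA-Same and Sync-DPDA-Arb is undecidable. -/

import Mathlib

/-- A (complete, real-time) deterministic push-down automaton with state set `Q`, input alphabet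
`A` and stack alphabet `Γ`, without start and final states.  Stack contents are words over `Γ`
whose right end is the top of the stack. -/
structure DPDA (Q A Γ : Type*) where
  /-- The transition function `δ : Q × A × Γ → Q × Γ*`. -/
  step : Q → A → Γ → Q × List Γ
  /-- The stack bottom symbol. -/
  bot : Γ
  /-- If a transition writes a word that contains the bottom symbol, then it does so only as the
  first letter of that word, and the symbol that it replaces is the bottom symbol. -/
  bot_bottom : ∀ q a x, bot ∈ (step q a x).2 →
    x = bot ∧ ∃ t : List Γ, (step q a x).2 = bot :: t ∧ bot ∉ t

namespace DPDA

variable {Q A Γ : Type*}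

/-- `M.Step a c c'`: reading the letter `a`, the configuration `c` becomes `c'`.  The topmost
(rightmost) stack symbol `x` is replaced by the word given by the transition function.  A
configuration with stack content `ε` has no successor. -/
def Step (M : DPDA Q A Γ) (a : A) (c c' : Q × List Γ) : Prop :=
  ∃ (v : List Γ) (x : Γ), c.2 = v ++ [x] ∧
    c' = ((M.step c.1 a x).1, v ++ (M.step c.1 a x).2)

/-- `M.Run w c c'`: reading the word `w`, the configuration `c` becomes `c'`. -/
def Run (M : DPDA Q A Γ) : List A → Q × List Γ → Q × List Γ → Prop
  | [], c, c' => c = c'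
  | a :: w, c, c' => ∃ d, M.Step a c d ∧ M.Run w d c'

/-- `w` synchronizes `M` in the empty stack model. -/
def SyncEmpty (M : DPDA Q A Γ) (w : List A) : Prop :=
  ∃ p : Q, ∀ q : Q, M.Run w (q, [M.bot]) (p, [M.bot])

/-- `w` synchronizes `M` in the same stack model. -/
def SyncSame (M : DPDA Q A Γ) (w : List A) : Prop :=
  ∃ (p : Q) (v : List Γ), ∀ q : Q, M.Run w (q, [M.bot]) (p, v)

/-- `w` synchronizes `M` in the arbitrary stack model. -/
def SyncArb (M : DPDA Q A Γ) (w : List A) : Prop :=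
  ∃ p : Q, ∀ q : Q, ∃ v : List Γ, M.Run w (q, [M.bot]) (p, v)

end DPDA

/-- Problem instances: a DPDA with finite non-empty state set, finite input alphabet and finite
stack alphabet.  Up to renaming, these sets are initial segments of `ℕ`. -/
structure FinDPDA where
  numStates : ℕ
  numLetters : ℕ
  numStackSymbols : ℕ
  numStates_pos : 0 < numStates
  machine : DPDA (Fin numStates) (Fin numLetters) (Fin numStackSymbols)

namespace FinDPDA

/-- Finite descriptions of DPDAs: the three cardinalities, the bottom symbol, and the
three-dimensional table of the transition function. -/
abbrev Code : Type :=
  ℕ × ℕ × ℕ × ℕ × List (List (List (ℕ × List ℕ)))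

/-- The description of an instance: the entry of the table at row `q`, column `a`, depth `x` is
the value of the transition function at `(q, a, x)`. -/
def encode (M : FinDPDA) : Code :=
  (M.numStates, M.numLetters, M.numStackSymbols, M.machine.bot.val,
    List.ofFn fun q => List.ofFn fun a => List.ofFn fun x =>
      ((M.machine.step q a x).1.val, (M.machine.step q a x).2.map Fin.val))

/-- Different instances have different descriptions. -/
theorem encode_injective : Function.Injective encode := by
  rintro ⟨n, m, k, hn, ⟨s, b, hb⟩⟩ ⟨n', m', k', hn', ⟨s', b', hb'⟩⟩ h
  simp only [encode, Prod.mk.injEq] at h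
  obtain ⟨rfl, rfl, rfl, h4, h5⟩ := h
  have e : b = b' := Fin.ext h4
  have es : s = s' := by
    funext q a x
    have h6 := congrFun (List.ofFn_injective h5) q
    have h7 := congrFun (List.ofFn_injective h6) a
    have h8 := congrFun (List.ofFn_injective h7) x
    simp only [Prod.mk.injEq] at h8
    exact Prod.ext (Fin.ext h8.1) (List.map_injective_iff.2 Fin.val_injective h8.2)
  subst e es
  rfl

/-- A decision problem about DPDAs is undecidable if no computable function, given the
description of a DPDA, answers the question correctly for every DPDA.  (Nothing is demanded of
such a function on inputs that do not describe a DPDA.) -/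
def Undecidable (P : FinDPDA → Prop) : Prop :=
  ¬ ∃ f : Code → Bool, Computable f ∧ ∀ M : FinDPDA, f M.encode = true ↔ P M

end FinDPDA

/-- Sync-DPDA-Empty: is there a word that synchronizes `M` in the empty stack model? -/
def SyncDPDAEmpty (M : FinDPDA) : Prop :=
  ∃ w : List (Fin M.numLetters), M.machine.SyncEmpty w

/-- Sync-DPDA-Same: is there a word that synchronizes `M` in the same stack model? -/
def SyncDPDASame (M : FinDPDA) : Prop :=
  ∃ w : List (Fin M.numLetters), M.machine.SyncSame w

/-- Sync-DPDA-Arb: is there a word that synchronizes `M` in the arbitrary stack model? -/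
def SyncDPDAArb (M : FinDPDA) : Prop :=
  ∃ w : List (Fin M.numLetters), M.machine.SyncArb w

/-! The halting problem of a fixed machine with several stacks is reduced to synchronization. The
DPDA `syncMachine` has one copy of the machine per stack. An input letter guesses the tops of all
stacks; each copy sees only its own stack, checks its own component of the guess, and follows the
transition. Since all copies read the same word, the guess is right in every component, so together
they simulate the machine.

A wrong guess leaves the state unchanged and pushes `error`, which is never removed. As `done` is
absorbing, it is the only possible synchronizing state, and a copy enters it only with an empty
simulated stack in the halting state. Hence acceptance yields a word synchronizing in the empty
stack model (`exists_syncEmpty_of_accepts`), while even the arbitrary stack model forces acceptance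
(`accepts_of_syncArb`). On these instances the three problems coincide, so one reduction serves all.

The machine comes from a partial recursive function with undecidable domain, compiled to a `TM2`
program. Only the initial stacks depend on the input, so the transition table is computable from it.
-/

namespace DPDA

/-! ### Runs of a DPDA and renaming of its alphabets -/

variable {Q A Γ : Type*}

theorem step_append_singleton_iff (M : DPDA Q A Γ) (a : A) (p : Q) (v : List Γ) (x : Γ)
    (c : Q × List Γ) :
    M.Step a (p, v ++ [x]) c ↔ c = ((M.step p a x).1, v ++ (M.step p a x).2) := by
  constructor
  · rintro ⟨v', x', h, rfl⟩
    obtain ⟨rfl, h⟩ := List.append_inj' h rfl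
    obtain rfl : x = x' := by simpa using h
    rfl
  · rintro rfl
    exact ⟨v, x, rfl, rfl⟩

theorem step_singleton_iff (M : DPDA Q A Γ) (a : A) (p : Q) (x : Γ) (c : Q × List Γ) :
    M.Step a (p, [x]) c ↔ c = M.step p a x :=
  M.step_append_singleton_iff a p [] x c

theorem Run.append {M : DPDA Q A Γ} {w₁ w₂ : List A} {c d e : Q × List Γ}
    (h₁ : M.Run w₁ c d) (h₂ : M.Run w₂ d e) : M.Run (w₁ ++ w₂) c e := by
  induction w₁ generalizing c with
  | nil => obtain rfl : c = d := h₁; exact h₂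
  | cons a w ih => obtain ⟨c', hs, hr⟩ := h₁; exact ⟨c', hs, ih hr⟩

theorem Step.unique {M : DPDA Q A Γ} {a : A} {c d e : Q × List Γ} (hd : M.Step a c d)
    (he : M.Step a c e) : d = e := by
  obtain ⟨v, x, h, rfl⟩ := hd
  rw [show c = (c.1, v ++ [x]) from Prod.ext rfl h, step_append_singleton_iff] at he
  exact he.symm

theorem Run.unique {M : DPDA Q A Γ} {w : List A} {c d e : Q × List Γ} (hd : M.Run w c d)
    (he : M.Run w c e) : d = e := by
  induction w generalizing c with
  | nil => exact hd.symm.trans he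
  | cons a w ih =>
    obtain ⟨c₁, h₁, hd⟩ := hd
    obtain ⟨c₂, h₂, he⟩ := he
    exact ih hd (h₁.unique h₂ ▸ he)

theorem SyncEmpty.syncSame {M : DPDA Q A Γ} {w : List A} (h : M.SyncEmpty w) : M.SyncSame w :=
  let ⟨p, hp⟩ := h
  ⟨p, [M.bot], hp⟩

theorem SyncSame.syncArb {M : DPDA Q A Γ} {w : List A} (h : M.SyncSame w) : M.SyncArb w :=
  let ⟨p, v, hp⟩ := h
  ⟨p, fun q => ⟨v, hp q⟩⟩

section Reindex

variable {Q' A' Γ' : Type*}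

/-- Renaming the states, letters and stack symbols of a DPDA. -/
def reindex (M : DPDA Q A Γ) (eQ : Q ≃ Q') (eA : A ≃ A') (eΓ : Γ ≃ Γ') : DPDA Q' A' Γ' where
  step q a x :=
    (eQ (M.step (eQ.symm q) (eA.symm a) (eΓ.symm x)).1,
      (M.step (eQ.symm q) (eA.symm a) (eΓ.symm x)).2.map eΓ)
  bot := eΓ M.bot
  bot_bottom q a x h := by
    have h' := M.bot_bottom (eQ.symm q) (eA.symm a) (eΓ.symm x) (by simpa using h)
    obtain ⟨hx, t, ht, hb⟩ := h'
    refine ⟨by simp [← hx], t.map eΓ, by simp [ht], by simpa using hb⟩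

theorem reindex_symm (M : DPDA Q A Γ) (eQ : Q ≃ Q') (eA : A ≃ A') (eΓ : Γ ≃ Γ') :
    (M.reindex eQ eA eΓ).reindex eQ.symm eA.symm eΓ.symm = M := by
  cases M
  simp [reindex]

theorem Run.reindex {M : DPDA Q A Γ} (eQ : Q ≃ Q') (eA : A ≃ A') (eΓ : Γ ≃ Γ') {w : List A}
    {p q : Q} {u v : List Γ} (h : M.Run w (p, u) (q, v)) :
    (M.reindex eQ eA eΓ).Run (w.map eA) (eQ p, u.map eΓ) (eQ q, v.map eΓ) := by
  induction w generalizing p u with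
  | nil =>
    obtain ⟨rfl, rfl⟩ := Prod.mk.inj h
    rfl
  | cons a w ih =>
    obtain ⟨d, ⟨t, x, ht, rfl⟩, hr⟩ := h
    obtain rfl : u = t ++ [x] := ht
    exact ⟨_, ⟨t.map eΓ, eΓ x, by simp, rfl⟩, by simpa [DPDA.reindex] using ih hr⟩

theorem SyncEmpty.reindex {M : DPDA Q A Γ} (eQ : Q ≃ Q') (eA : A ≃ A') (eΓ : Γ ≃ Γ') {w : List A}
    (h : M.SyncEmpty w) : (M.reindex eQ eA eΓ).SyncEmpty (w.map eA) := by
  obtain ⟨p, hp⟩ := h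
  refine ⟨eQ p, fun q => ?_⟩
  simpa using! (hp (eQ.symm q)).reindex eQ eA eΓ

theorem SyncArb.reindex {M : DPDA Q A Γ} (eQ : Q ≃ Q') (eA : A ≃ A') (eΓ : Γ ≃ Γ') {w : List A}
    (h : M.SyncArb w) : (M.reindex eQ eA eΓ).SyncArb (w.map eA) := by
  obtain ⟨p, hp⟩ := h
  refine ⟨eQ p, fun q => ?_⟩
  obtain ⟨v, hv⟩ := hp (eQ.symm q)
  exact ⟨v.map eΓ, by simpa using! hv.reindex eQ eA eΓ⟩

end Reindex

end DPDA

/-! ### Multi-stack machines -/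

/-- A deterministic machine without input that operates on a family of stacks. In one step it
sees the tops of all stacks and replaces each of them by a word. -/
structure MultiStack (K S G : Type*) where
  step : S → (K → Option G) → S × (K → List G)

namespace MultiStack

variable {K S G : Type*}

/-- The tops of a family of stacks; stacks are lists whose head is the top. -/
def tops (st : K → List G) (k : K) : Option G := (st k).head?

/-- The successor of a configuration. -/
def next (N : MultiStack K S G) (c : S × (K → List G)) : S × (K → List G) :=
  ((N.step c.1 (tops c.2)).1, fun k => (N.step c.1 (tops c.2)).2 k ++ (c.2 k).tail)

/-- The machine accepts if it reaches the state `h` with all stacks empty. -/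
def Accepts (N : MultiStack K S G) (h : S) (c : S × (K → List G)) : Prop :=
  ∃ n, N.next^[n] c = (h, fun _ => [])

theorem Accepts.of_next {N : MultiStack K S G} {h : S} {c : S × (K → List G)}
    (hc : N.Accepts h (N.next c)) : N.Accepts h c :=
  let ⟨n, hn⟩ := hc
  ⟨n + 1, hn⟩

/-- The restriction of a machine to a set of states that is closed under transitions. -/
def restrict (N : MultiStack K S G) (T : Finset S) (hT : ∀ s ∈ T, ∀ t, (N.step s t).1 ∈ T) :
    MultiStack K T G where
  step s t := (⟨(N.step s t).1, hT s s.2 t⟩, (N.step s t).2)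

/-- The inclusion of `T` intertwines the two successor maps and is injective. This serves to make
the state set finite. -/
theorem restrict_accepts_iff (N : MultiStack K S G) (T : Finset S)
    (hT : ∀ s ∈ T, ∀ t, (N.step s t).1 ∈ T) (h s : T) (st : K → List G) :
    (N.restrict T hT).Accepts h (s, st) ↔ N.Accepts h (s, st) := by
  have key (n : ℕ) (c : T × (K → List G)) :
      Prod.map Subtype.val id ((N.restrict T hT).next^[n] c) =
        N.next^[n] (Prod.map Subtype.val id c) :=
    (Function.Semiconj.iterate_right (f := Prod.map Subtype.val id)
      (ga := (N.restrict T hT).next) (gb := N.next) (fun _ => rfl) n) c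
  refine exists_congr fun n => ?_
  rw [show ((s : S), st) = Prod.map Subtype.val id (s, st) from rfl, ← key n (s, st)]
  have hinj : Function.Injective (Prod.map (Subtype.val : T → S) (id : (K → List G) → _)) :=
    Subtype.val_injective.prodMap Function.injective_id
  exact (hinj.eq_iff (b := (h, fun _ => []))).symm

end MultiStack

/-! ### `TM2` programs as multi-stack machines -/

theorem Turing.TM2.some_mem_stmts {K Λ σ : Type*} {Γ : K → Type*} {M : Λ → TM2.Stmt Γ Λ σ}
    {L : Finset Λ} {l : Λ} (hl : l ∈ L) : some (M l) ∈ TM2.stmts M L := by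
  classical
  exact Finset.some_mem_insertNone.2 (Finset.mem_biUnion.2 ⟨l, hl, TM2.stmts₁_self⟩)

section StackProgram

open Turing Turing.TM2 StateTransition

variable {K G Λ σ : Type*} [DecidableEq K]

/-- The machine that executes a `TM2` program statement by statement. Having halted, it clears its
stacks. -/
def stmtMachine (M : Λ → Stmt (fun _ : K => G) Λ σ) (v₀ : σ) :
    MultiStack K (Stmt (fun _ : K => G) Λ σ × σ) G where
  step s t := match s with
    | (.push k f q, v) =>
      ((q, v), Function.update (fun i => (t i).toList) k (f v :: (t k).toList))
    | (.peek k f q, v) => ((q, f v (t k)), fun i => (t i).toList)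
    | (.pop k f q, v) => ((q, f v (t k)), Function.update (fun i => (t i).toList) k [])
    | (.load a q, v) => ((q, a v), fun i => (t i).toList)
    | (.branch p q₁ q₂, v) => ((cond (p v) q₁ q₂, v), fun i => (t i).toList)
    | (.goto l, v) => ((M (l v), v), fun i => (t i).toList)
    | (.halt, _) => ((.halt, v₀), fun _ => [])

theorem head?_toList_append_tail (l : List G) : l.head?.toList ++ l.tail = l := by
  cases l <;> rfl

section next

variable (M : Λ → Stmt (fun _ : K => G) Λ σ) (v₀ v : σ) (q q₁ q₂ : Stmt (fun _ : K => G) Λ σ)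
  (k : K) (st : K → List G)

theorem stmtMachine_next_push (f : σ → G) :
    (stmtMachine M v₀).next ((.push k f q, v), st) =
      ((q, v), Function.update st k (f v :: st k)) := by
  refine Prod.ext rfl (funext fun i => ?_)
  by_cases h : i = k
  · subst h; simp [MultiStack.next, stmtMachine, MultiStack.tops, head?_toList_append_tail]
  · simp [MultiStack.next, stmtMachine, MultiStack.tops, head?_toList_append_tail, h]

theorem stmtMachine_next_pop (f : σ → Option G → σ) :
    (stmtMachine M v₀).next ((.pop k f q, v), st) =
      ((q, f v (st k).head?), Function.update st k (st k).tail) := by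
  refine Prod.ext rfl (funext fun i => ?_)
  by_cases h : i = k
  · subst h; simp [MultiStack.next, stmtMachine]
  · simp [MultiStack.next, stmtMachine, MultiStack.tops, head?_toList_append_tail, h]

theorem stmtMachine_next_peek (f : σ → Option G → σ) :
    (stmtMachine M v₀).next ((.peek k f q, v), st) = ((q, f v (st k).head?), st) :=
  Prod.ext rfl (funext fun i => head?_toList_append_tail (st i))

theorem stmtMachine_next_load (a : σ → σ) :
    (stmtMachine M v₀).next ((.load a q, v), st) = ((q, a v), st) :=
  Prod.ext rfl (funext fun i => head?_toList_append_tail (st i))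

theorem stmtMachine_next_branch (p : σ → Bool) :
    (stmtMachine M v₀).next ((.branch p q₁ q₂, v), st) = ((cond (p v) q₁ q₂, v), st) :=
  Prod.ext rfl (funext fun i => head?_toList_append_tail (st i))

theorem stmtMachine_next_goto (l : σ → Λ) :
    (stmtMachine M v₀).next ((.goto l, v), st) = ((M (l v), v), st) :=
  Prod.ext rfl (funext fun i => head?_toList_append_tail (st i))

end next

/-- Each step in `halt` drops one letter from every nonempty stack, so halting always ends in a
single configuration. -/
theorem stmtMachine_accepts_halt [Fintype K] (M : Λ → Stmt (fun _ : K => G) Λ σ) (v₀ v : σ)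
    (st : K → List G) : (stmtMachine M v₀).Accepts (.halt, v₀) ((.halt, v), st) := by
  have aux (n : ℕ) : ∀ st : K → List G, (∀ k, (st k).length ≤ n) →
      (stmtMachine M v₀).Accepts (.halt, v₀) ((.halt, v₀), st) := by
    induction n with
    | zero =>
      intro st h
      exact ⟨0, Prod.ext rfl (funext fun k => List.length_eq_zero_iff.1 (Nat.le_zero.1 (h k)))⟩
    | succ n ih =>
      intro st h
      refine .of_next (ih _ fun k => ?_)
      have := h k
      change ((st k).tail).length ≤ n
      rw [List.length_tail]
      omega
  -- One step replaces `v` by `v₀`; the total length then bounds the height of every stack.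
  exact .of_next (aux (∑ k, (st k).length) _ fun k => by
    have := Finset.single_le_sum (f := fun k => (st k).length) (fun _ _ => Nat.zero_le _)
      (Finset.mem_univ k)
    change ((st k).tail).length ≤ _
    rw [List.length_tail]
    exact (Nat.sub_le _ _).trans this)

/-- The configuration of `stmtMachine M v₀` that corresponds to a configuration of `M`. -/
def stmtCfg (M : Λ → Stmt (fun _ : K => G) Λ σ) (c : Cfg (fun _ : K => G) Λ σ) :
    (Stmt (fun _ : K => G) Λ σ × σ) × (K → List G) :=
  ((c.l.elim .halt M, c.var), c.stk)

theorem stmtMachine_accepts_of_stepAux [Fintype K] (M : Λ → Stmt (fun _ : K => G) Λ σ) (v₀ : σ)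
    (q : Stmt (fun _ : K => G) Λ σ) (v : σ) (st : K → List G)
    (h : (stmtMachine M v₀).Accepts (.halt, v₀) (stmtCfg M (stepAux q v st))) :
    (stmtMachine M v₀).Accepts (.halt, v₀) ((q, v), st) := by
  induction q generalizing v st with
  | push k f q ih => exact .of_next (stmtMachine_next_push M v₀ v q k st f ▸ ih _ _ h)
  | peek k f q ih => exact .of_next (stmtMachine_next_peek M v₀ v q k st f ▸ ih _ _ h)
  | pop k f q ih => exact .of_next (stmtMachine_next_pop M v₀ v q k st f ▸ ih _ _ h)
  | load a q ih => exact .of_next (stmtMachine_next_load M v₀ v q st a ▸ ih _ _ h)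
  | branch p q₁ q₂ ih₁ ih₂ =>
    refine .of_next (stmtMachine_next_branch M v₀ v q₁ q₂ st p ▸ ?_)
    cases hp : p v
    · exact ih₂ _ _ (by simpa [hp] using h)
    · exact ih₁ _ _ (by simpa [hp] using h)
  | goto l => exact .of_next (stmtMachine_next_goto M v₀ v st l ▸ h)
  | halt => exact stmtMachine_accepts_halt M v₀ v st

/-- Executing a single statement does not change the value of `stepAux`, except that `goto` consumes
one step of `TM2.step`. -/
theorem eval_stepAux_dom_of_iterate (M : Λ → Stmt (fun _ : K => G) Λ σ) (v₀ : σ) (n : ℕ)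
    (q : Stmt (fun _ : K => G) Λ σ) (v : σ) (st : K → List G)
    (h : (stmtMachine M v₀).next^[n] ((q, v), st) = ((.halt, v₀), fun _ => [])) :
    (eval (TM2.step M) (stepAux q v st)).Dom := by
  induction n generalizing q v st with
  | zero =>
    obtain rfl : q = .halt := by simpa using congrArg (fun c => c.1.1) h
    exact Part.dom_iff_mem.2 ⟨_, mem_eval.2 ⟨.refl, rfl⟩⟩
  | succ n ih =>
    rw [Function.iterate_succ_apply] at h
    cases q with
    | push k f q => rw [stmtMachine_next_push] at h; exact (ih _ _ _ h :)
    | peek k f q => rw [stmtMachine_next_peek] at h; exact (ih _ _ _ h :)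
    | pop k f q => rw [stmtMachine_next_pop] at h; exact (ih _ _ _ h :)
    | load a q => rw [stmtMachine_next_load] at h; exact (ih _ _ _ h :)
    | branch p q₁ q₂ =>
      rw [stmtMachine_next_branch] at h
      have := ih _ _ _ h
      cases hp : p v <;> simpa [hp] using this
    | goto l =>
      rw [stmtMachine_next_goto] at h
      rw [stepAux, reaches_eval (f := TM2.step M) (.single (b := stepAux (M (l v)) v st) rfl)]
      exact ih _ _ _ h
    | halt => exact Part.dom_iff_mem.2 ⟨_, mem_eval.2 ⟨.refl, rfl⟩⟩

theorem stmtMachine_accepts_iff [Fintype K] (M : Λ → Stmt (fun _ : K => G) Λ σ) (v₀ : σ) (l : Λ)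
    (v : σ) (st : K → List G) :
    (stmtMachine M v₀).Accepts (.halt, v₀) ((M l, v), st) ↔
      (eval (TM2.step M) ⟨some l, v, st⟩).Dom := by
  constructor
  · rintro ⟨n, hn⟩
    rw [reaches_eval (f := TM2.step M) (.single (b := stepAux (M l) v st) rfl)]
    exact eval_stepAux_dom_of_iterate M v₀ n _ _ _ hn
  · intro h
    obtain ⟨b, hb⟩ := Part.dom_iff_mem.1 h
    obtain ⟨hr, hb⟩ := mem_eval.1 hb
    -- Acceptance propagates backwards along the computation from its halting configuration.
    suffices ∀ c, Reaches (TM2.step M) c b →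
        (stmtMachine M v₀).Accepts (.halt, v₀) (stmtCfg M c) from this _ hr
    intro c hc
    induction hc using Relation.ReflTransGen.head_induction_on with
    | refl =>
      obtain ⟨_ | l, v, st⟩ := b
      · exact stmtMachine_accepts_halt M v₀ v st
      · simp at hb
    | @head c d hs _ ih =>
      obtain ⟨_ | l, v, st⟩ := c
      · simp at hs
      · obtain rfl : stepAux (M l) v st = d := by simpa using hs
        exact stmtMachine_accepts_of_stepAux M v₀ _ _ _ ih

/-- Only substatements of the programs at the finitely many supported labels occur. -/
theorem stmtMachine_step_mem [Inhabited Λ] {M : Λ → Stmt (fun _ : K => G) Λ σ}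
    {L : Finset Λ} (hL : Supports M L) (v₀ : σ) (s : Stmt (fun _ : K => G) Λ σ × σ)
    (hs : s.1 = .halt ∨ some s.1 ∈ stmts M L) (t : K → Option G) :
    ((stmtMachine M v₀).step s t).1.1 = .halt ∨
      some ((stmtMachine M v₀).step s t).1.1 ∈ stmts M L := by
  classical
  obtain ⟨q, v⟩ := s
  obtain rfl | hs := hs
  · exact .inl rfl
  right
  have sub {q'} (h : q' ∈ stmts₁ q) : some q' ∈ stmts M L := stmts_trans h hs
  cases q with
  | branch p q₁ q₂ =>
    apply sub
    cases hp : p v <;> simp [stmtMachine, stmts₁, hp, stmts₁_self]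
  | goto l => exact some_mem_stmts (stmts_supportsStmt hL hs v)
  | _ => exact sub (by simp [stmtMachine, stmts₁, stmts₁_self])

end StackProgram

/-! ### The synchronization gadget -/

/-- Input letters of `syncMachine`: put the initial words on the stacks, execute one step in which
the tops of the stacks are as given, or end the simulation. -/
inductive SyncLetter (K G : Type*)
  | load
  | advance (t : K → Option G)
  | merge

/-- States of `syncMachine`: for each stack of the simulated machine a copy that has not yet been
loaded, and a copy of each state, which keeps track of that stack; and a common final state. -/
inductive SyncState (K S : Type*)
  | start (k : K)
  | run (k : K) (s : S)
  | done

/-- Stack symbols of `syncMachine`. -/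
inductive SyncSymbol (G : Type*)
  | bottom
  | error
  | letter (g : G)

instance {K G : Type*} [Finite K] [Finite G] : Finite (SyncLetter K G) :=
  Finite.of_injective (β := Option (Option (K → Option G)))
    (fun | .load => none | .merge => some none | .advance t => some (some t))
    (by rintro (_ | _ | _) (_ | _ | _) <;> simp)

instance {K S : Type*} [Finite K] [Finite S] : Finite (SyncState K S) :=
  Finite.of_injective (β := Option (K × Option S))
    (fun | .start k => some (k, none) | .run k s => some (k, some s) | .done => none)
    (by rintro (_ | _ | _) (_ | _ | _) <;> simp)

instance {G : Type*} [Finite G] : Finite (SyncSymbol G) :=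
  Finite.of_injective (β := Option (Option G))
    (fun | .bottom => none | .error => some none | .letter g => some (some g))
    (by rintro (_ | _ | _) (_ | _ | _) <;> simp)

namespace MultiStack

variable {K S G : Type*} (N : MultiStack K S G) (h s₀ : S)

open SyncLetter SyncState SyncSymbol

/-- The stack symbol that is visible when the top of the simulated stack is as given. -/
def topSymbol : Option G → SyncSymbol G
  | none => bottom
  | some g => letter g

/-- The word, bottom first, that represents the given word of the simulated machine. -/
def symbols (l : List G) : List (SyncSymbol G) := l.reverse.map letter

/-- The word that stays below whatever replaces the given symbol. -/
def keep : SyncSymbol G → List (SyncSymbol G)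
  | bottom => [bottom]
  | _ => []

open Classical in
/-- The transition function of `syncMachine`. A transition that is not foreseen pushes `error`,
which stays on the top for ever. -/
noncomputable def syncStep (ini : K → List G) (q : SyncState K S) (a : SyncLetter K G)
    (x : SyncSymbol G) : SyncState K S × List (SyncSymbol G) :=
  match q, a with
  | done, _ => (done, [x])
  | start k, load | run k _, load =>
    if x = bottom then (run k s₀, bottom :: symbols (ini k)) else (q, [x, error])
  | run k s, advance t =>
    if x = topSymbol (t k) then (run k (N.step s t).1, keep x ++ symbols ((N.step s t).2 k))
    else (q, [x, error])
  | run _ s, merge => if x = bottom ∧ s = h then (done, [bottom]) else (q, [x, error])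
  | start _, _ => (q, [x, error])

theorem bottom_notMem_symbols (l : List G) : bottom ∉ symbols l := by simp [symbols]

/-- A DPDA whose copies check, each for one of the stacks, that the input word describes an
accepting computation of `N` from the state `s₀` and the stacks `ini` to the state `h`. -/
noncomputable def syncMachine (ini : K → List G) :
    DPDA (SyncState K S) (SyncLetter K G) (SyncSymbol G) where
  step := N.syncStep h s₀ ini
  bot := bottom
  bot_bottom q a x := by
    have hs := bottom_notMem_symbols (G := G)
    cases q <;> cases a <;> cases x <;> simp only [syncStep] <;> (try split_ifs) <;>
      simp_all [keep]

/-- The stack content of the copy that keeps track of the stack `l`. -/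
def stackWord (l : List G) : List (SyncSymbol G) := bottom :: symbols l

variable {N h s₀} {ini : K → List G}

theorem stackWord_nil : stackWord ([] : List G) = [bottom] := rfl

theorem stackWord_cons (g : G) (l : List G) :
    stackWord (g :: l) = stackWord l ++ [letter g] := by
  simp [stackWord, symbols]

theorem stackWord_append (l l' : List G) : stackWord (l' ++ l) = stackWord l ++ symbols l' := by
  simp [stackWord, symbols]

theorem exists_stackWord_eq (l : List G) : ∃ v, stackWord l = v ++ [topSymbol l.head?] ∧
    stackWord l.tail = v ++ keep (topSymbol l.head?) := by
  cases l with
  | nil => exact ⟨[], rfl, rfl⟩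
  | cons g l => exact ⟨stackWord l, stackWord_cons g l, by simp [topSymbol, keep]⟩

theorem topSymbol_injective : Function.Injective (topSymbol : Option G → SyncSymbol G) := by
  rintro (_ | _) (_ | _) <;> simp [topSymbol]

theorem topSymbol_eq_bottom {l : List G} : topSymbol l.head? = bottom ↔ l = [] := by
  cases l <;> simp [topSymbol]

/-- No transition is foreseen for `error`, so every letter keeps the state and pushes another
`error`. -/
theorem fst_ne_done_of_run {w : List (SyncLetter K G)} {p : SyncState K S} (hp : p ≠ done)
    {v : List (SyncSymbol G)} {c : SyncState K S × List (SyncSymbol G)}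
    (hr : (N.syncMachine h s₀ ini).Run w (p, v ++ [error]) c) : c.1 ≠ done := by
  induction w generalizing v with
  | nil => obtain rfl : _ = c := hr; exact hp
  | cons a w ih =>
    obtain ⟨d, hd, hr⟩ := hr
    rw [DPDA.step_append_singleton_iff] at hd
    have e : (N.syncMachine h s₀ ini).step p a error = (p, [error, error]) := by
      have ht (o : Option G) : error ≠ topSymbol o := by cases o <;> simp [topSymbol]
      cases p <;> cases a <;> simp_all [syncMachine, syncStep]
    rw [e] at hd
    subst hd
    exact ih (v := v ++ [error]) (by simpa using hr)

theorem not_run_of_step_eq_error {a : SyncLetter K G} {w : List (SyncLetter K G)}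
    {p : SyncState K S} (hp : p ≠ done) {v u : List (SyncSymbol G)} {x : SyncSymbol G}
    (hs : (N.syncMachine h s₀ ini).step p a x = (p, [x, error])) :
    ¬ (N.syncMachine h s₀ ini).Run (a :: w) (p, v ++ [x]) (done, u) := by
  rintro ⟨d, hd, hr⟩
  rw [DPDA.step_append_singleton_iff, hs] at hd
  subst hd
  exact fst_ne_done_of_run hp (v := v ++ [x]) (by simpa using hr) rfl

theorem run_done (w : List (SyncLetter K G)) (v : List (SyncSymbol G)) (x : SyncSymbol G) :
    (N.syncMachine h s₀ ini).Run w (done, v ++ [x]) (done, v ++ [x]) := by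
  induction w with
  | nil => rfl
  | cons a w ih => exact ⟨_, (DPDA.step_append_singleton_iff ..).2 rfl, ih⟩

theorem step_advance {s : S} {st : K → List G} (k : K) :
    (N.syncMachine h s₀ ini).Step (advance (tops st)) (run k s, stackWord (st k))
      (run k (N.next (s, st)).1, stackWord ((N.next (s, st)).2 k)) := by
  obtain ⟨v, h₁, h₂⟩ := exists_stackWord_eq (st k)
  rw [h₁, DPDA.step_append_singleton_iff]
  simp [syncMachine, syncStep, tops, next, stackWord_append, h₂]

theorem exists_run_iterate (n : ℕ) (c : S × (K → List G)) :
    ∃ w, ∀ k, (N.syncMachine h s₀ ini).Run w (run k c.1, stackWord (c.2 k))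
      (run k (N.next^[n] c).1, stackWord ((N.next^[n] c).2 k)) := by
  induction n generalizing c with
  | zero => exact ⟨[], fun _ => rfl⟩
  | succ n ih =>
    obtain ⟨w, hw⟩ := ih (N.next c)
    exact ⟨advance (tops c.2) :: w, fun k => ⟨_, step_advance k, hw k⟩⟩

theorem exists_syncEmpty_of_accepts (hc : N.Accepts h (s₀, ini)) :
    ∃ w, (N.syncMachine h s₀ ini).SyncEmpty w := by
  obtain ⟨n, hn⟩ := hc
  obtain ⟨w, hw⟩ := exists_run_iterate (N := N) (h := h) (s₀ := s₀) (ini := ini) n (s₀, ini)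
  rw [hn] at hw
  have key (k : K) : (N.syncMachine h s₀ ini).Run (w ++ [merge]) (run k s₀, stackWord (ini k))
      (done, [bottom]) := by
    refine (hw k).append ⟨_, (DPDA.step_singleton_iff ..).2 rfl, ?_⟩
    simp [syncMachine, syncStep, DPDA.Run]
  -- The initial `load` also resets the copies that start in an arbitrary state `run k s`.
  refine ⟨load :: (w ++ [merge]), done, fun q => ?_⟩
  cases q with
  | done => exact run_done _ [] _
  | start k => exact ⟨_, (DPDA.step_singleton_iff ..).2 (by simp [syncMachine, syncStep, stackWord]), key k⟩
  | run k s => exact ⟨_, (DPDA.step_singleton_iff ..).2 (by simp [syncMachine, syncStep, stackWord]), key k⟩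

/-- Every letter read must be foreseen by all copies. The second alternative covers a later `load`,
which restarts the simulation from `ini`. -/
theorem accepts_of_run [Nonempty K] (w : List (SyncLetter K G)) (s : S) (st : K → List G)
    (hw : ∀ k, ∃ v, (N.syncMachine h s₀ ini).Run w (run k s, stackWord (st k)) (done, v)) :
    N.Accepts h (s, st) ∨ N.Accepts h (s₀, ini) := by
  induction w generalizing s st with
  | nil =>
    obtain ⟨v, hv⟩ := hw (Classical.arbitrary K)
    cases hv
  | cons a w ih =>
    have foreseen (k : K) : (N.syncMachine h s₀ ini).step (run k s) a (topSymbol (st k).head?) ≠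
        (run k s, [topSymbol (st k).head?, error]) := by
      intro he
      obtain ⟨v, hv, -⟩ := exists_stackWord_eq (st k)
      obtain ⟨u, hu⟩ := hw k
      rw [hv] at hu
      exact not_run_of_step_eq_error (by simp) he hu
    cases a with
    | load =>
      refine .inr ((ih s₀ ini fun k => ?_).elim id id)
      have hk : st k = [] := by
        by_contra hk
        exact foreseen k (by simp [syncMachine, syncStep, topSymbol_eq_bottom, hk])
      obtain ⟨v, d, hd, hr⟩ := hw k
      rw [hk, stackWord_nil, DPDA.step_singleton_iff] at hd
      obtain rfl : d = (run k s₀, stackWord (ini k)) := by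
        simpa [syncMachine, syncStep] using! hd
      exact ⟨v, hr⟩
    | advance t =>
      have ht : t = tops st := by
        funext k
        by_contra hk
        exact foreseen k (by
          simp only [syncMachine, syncStep]
          exact if_neg fun e => hk (topSymbol_injective e).symm)
      subst ht
      refine (ih _ _ fun k => ?_).imp_left (Accepts.of_next (c := (s, st)))
      obtain ⟨v, d, hd, hr⟩ := hw k
      have hd' := step_advance (N := N) (h := h) (s₀ := s₀) (ini := ini) (s := s) (st := st) k
      obtain ⟨u, hu, -⟩ := exists_stackWord_eq (st k)
      rw [hu, DPDA.step_append_singleton_iff] at hd hd'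
      rw [hd, ← hd'] at hr
      exact ⟨v, hr⟩
    | merge =>
      have hm (k : K) : st k = [] ∧ s = h := by
        by_contra hk
        exact foreseen k (by 
          simp only [syncMachine, syncStep]
          exact if_neg (by rwa [topSymbol_eq_bottom]))
      exact .inl ⟨0, Prod.ext (hm (Classical.arbitrary K)).2 (funext fun k => (hm k).1)⟩

theorem accepts_of_syncArb [Nonempty K] {w : List (SyncLetter K G)}
    (hw : (N.syncMachine h s₀ ini).SyncArb w) : N.Accepts h (s₀, ini) := by
  obtain ⟨p, hp⟩ := hw
  -- The state `done` is itself among the starting states and is never left.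
  obtain rfl : p = done := by
    by_contra hne
    obtain ⟨v, hv⟩ := hp done
    exact hne (congrArg Prod.fst
      (DPDA.Run.unique hv (run_done (N := N) (h := h) (s₀ := s₀) (ini := ini) w [] bottom)))
  cases w with
  | nil =>
    obtain ⟨v, hv⟩ := hp (start (Classical.arbitrary K))
    cases hv
  | cons a w =>
    by_cases ha : a = load
    · subst ha
      refine (accepts_of_run w s₀ ini fun k => ?_).elim id id
      obtain ⟨v, d, hd, hr⟩ := hp (start k)
      rw [DPDA.step_singleton_iff] at hd
      obtain rfl : d = (run k s₀, stackWord (ini k)) := by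
        simpa [syncMachine, syncStep] using! hd
      exact ⟨v, hr⟩
    -- A copy in state `start` tolerates no first letter but `load`.
    · obtain ⟨v, hv⟩ := hp (start (Classical.arbitrary K))
      refine (not_run_of_step_eq_error (v := []) (by simp) ?_ hv).elim
      cases a <;> first | exact (ha rfl).elim | rfl

open Classical in
/-- For fixed `q`, `a` and `x`, the dependence of the transition on the initial stacks. -/
theorem syncStep_dependence (N : MultiStack K S G) (h s₀ : S) (q : SyncState K S)
    (a : SyncLetter K G) (x : SyncSymbol G) :
    (∃ r, ∀ ini, N.syncStep h s₀ ini q a x = r) ∨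
      ∃ k, ∀ ini, N.syncStep h s₀ ini q a x = (run k s₀, bottom :: symbols (ini k)) := by
  have aux (q : SyncState K S) (k : K) :
      (∃ r : SyncState K S × List (SyncSymbol G), ∀ ini : K → List G,
        (if x = bottom then (run k s₀, bottom :: symbols (ini k)) else (q, [x, error])) = r) ∨
      ∃ k', ∀ ini : K → List G,
        (if x = bottom then (run k s₀, bottom :: symbols (ini k)) else (q, [x, error])) =
          (run k' s₀, bottom :: symbols (ini k')) := by
    by_cases hx : x = bottom
    · exact .inr ⟨k, fun _ => if_pos hx⟩
    · exact .inl ⟨_, fun _ => if_neg hx⟩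
  cases q <;> cases a <;> simp only [syncStep] <;>
    first | exact .inl ⟨_, fun _ => rfl⟩ | exact aux _ _

end MultiStack

/-! ### Computability of the reduction -/

namespace MultiStack

variable {K S G : Type*} [Finite K] [Finite S] [Finite G] (N : MultiStack K S G) (h s₀ : S)

/-- The problem instance given by `syncMachine`. -/
noncomputable def syncInstance (ini : K → List G) : FinDPDA where
  numStates := Nat.card (SyncState K S)
  numLetters := Nat.card (SyncLetter K G)
  numStackSymbols := Nat.card (SyncSymbol G)
  numStates_pos := Nat.card_pos_iff.2 ⟨⟨.done⟩, inferInstance⟩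
  machine := (N.syncMachine h s₀ ini).reindex (Finite.equivFin _) (Finite.equivFin _)
    (Finite.equivFin _)

/-- The table has a fixed shape, and by `syncStep_dependence` each entry is constant or contains one
initial stack. The arbitrary `f` absorbs the numbering of the stack symbols. -/
theorem computable_encode_syncInstance {α : Type*} [Primcodable α] (ini : α → K → List G)
    (hini : ∀ k (f : G → ℕ), Computable fun n => (ini n k).map f) :
    Computable fun n => (N.syncInstance h s₀ (ini n)).encode := by
  simp only [FinDPDA.encode, syncInstance, DPDA.reindex, syncMachine]
  refine (Computable.const _).pair <| (Computable.const _).pair <| (Computable.const _).pair <|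
    (Computable.const _).pair <| Computable.list_ofFn fun q => Computable.list_ofFn fun a =>
    Computable.list_ofFn fun x => ?_
  obtain ⟨r, hr⟩ | ⟨k, hk⟩ := N.syncStep_dependence h s₀ ((Finite.equivFin _).symm q)
    ((Finite.equivFin _).symm a) ((Finite.equivFin _).symm x)
  · simp only [hr]
    exact Computable.const _
  · simp only [hk]
    refine (Computable.const _).pair ?_
    simp only [symbols, List.map_cons, List.map_reverse, List.map_map]
    exact Computable.list_cons.comp (Computable.const _) (Computable.list_reverse.comp (hini k _))

/-- Any `P` squeezed between the empty and the arbitrary stack model is equivalent to acceptance on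
the constructed instances. -/
theorem undecidable_of_accepts [Nonempty K] {α : Type*} [Primcodable α] (ini : α → K → List G)
    (hini : ∀ k (f : G → ℕ), Computable fun n => (ini n k).map f)
    (hN : ¬ ComputablePred fun n => N.Accepts h (s₀, ini n)) {P : FinDPDA → Prop}
    (hempty : ∀ M w, M.machine.SyncEmpty w → P M)
    (harb : ∀ M, P M → ∃ w, M.machine.SyncArb w) : FinDPDA.Undecidable P := by
  rintro ⟨f, hf, hP⟩
  refine hN (ComputablePred.computable_iff.2 ⟨_,
    hf.comp (N.computable_encode_syncInstance h s₀ ini hini), funext fun n => propext ?_⟩)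
  rw [hP]
  constructor
  · intro hn
    obtain ⟨w, hw⟩ := exists_syncEmpty_of_accepts hn
    exact hempty _ _ (hw.reindex _ _ _)
  · intro hn
    obtain ⟨w, hw⟩ := harb _ hn
    have : ((N.syncMachine h s₀ (ini n)).reindex _ _ _ |>.reindex _ _ _).SyncArb _ :=
      hw.reindex (Finite.equivFin (SyncState K S)).symm
      (Finite.equivFin (SyncLetter K G)).symm (Finite.equivFin (SyncSymbol G)).symm
    rw [DPDA.reindex_symm] at this
    exact accepts_of_syncArb this

end MultiStack

/-! ### Binary expansion is primitive recursive -/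

theorem Nat.bits_eq_cons {n : ℕ} (hn : n ≠ 0) : n.bits = n.bodd :: n.div2.bits := by
  conv_lhs => rw [← Nat.bit_bodd_div2 n]
  refine Nat.bits_append_bit _ _ fun h0 => ?_
  by_contra hb
  have := Nat.bit_bodd_div2 n
  simp_all

theorem Primrec.nat_bits : Primrec Nat.bits := by
  -- Strong recursion: `l` lists the earlier values, so its length is the current argument `n`, and
  -- the entry at `n.div2` gives the remaining bits.
  have hg : Primrec₂ fun (_ : Unit) (l : List (List Bool)) =>
      if l.length = 0 then some [] else
        l[l.length.div2]?.map fun t => l.length.bodd :: t := by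
    refine Primrec.ite ?_ (Primrec.const _) ?_
    · exact Primrec.eq.comp (Primrec.list_length.comp Primrec.snd) (Primrec.const 0)
    · refine Primrec.option_map (Primrec.list_getElem?.comp Primrec.snd
        (Primrec.nat_div2.comp (Primrec.list_length.comp Primrec.snd))) ?_
      exact Primrec.list_cons.comp (Primrec.nat_bodd.comp
        (Primrec.list_length.comp (Primrec.snd.comp Primrec.fst))) Primrec.snd
  have := Primrec.nat_strong_rec (fun (_ : Unit) n => n.bits) hg fun _ n => by
    by_cases hn : n = 0
    · simp [hn]
    · have hlt : n.div2 < n := Nat.binaryRec_decreasing hn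
      simp [hn, hlt, Nat.bits_eq_cons hn]
  exact this.comp (Primrec.const ()) Primrec.id

/-! ### A `TM2` program with undecidable halting -/

namespace Turing.PartrecToTM2

theorem trPosNum_eq_map_bits (p : PosNum) :
    trPosNum p = (p : ℕ).bits.map fun b => cond b Γ'.bit1 Γ'.bit0 := by
  induction p with
  | one => simp [trPosNum]
  | bit0 p ih =>
    have hp : (p : ℕ) ≠ 0 := p.to_nat_pos.ne'
    rw [PosNum.cast_bit0, ← two_mul, Nat.bit0_bits _ hp, trPosNum, ih]
    rfl
  | bit1 p ih =>
    rw [PosNum.cast_bit1, ← two_mul, Nat.bit1_bits, trPosNum, ih]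
    rfl

theorem trNat_eq_map_bits (n : ℕ) :
    trNat n = n.bits.map fun b => cond b Γ'.bit1 Γ'.bit0 := by
  have (m : Num) : trNum m = (m : ℕ).bits.map fun b => cond b Γ'.bit1 Γ'.bit0 := by
    cases m with
    | zero => simp [trNum]
    | pos p => exact trPosNum_eq_map_bits p
  rw [trNat, this, Num.to_of_nat]

theorem computable_map_trList_singleton (f : Γ' → ℕ) :
    Computable fun n => (trList [n]).map f := by
  simp only [trList, trNat_eq_map_bits, List.map_append, List.map_map]
  exact (Primrec.list_append.comp
    (Primrec.list_map Primrec.nat_bits (g := fun _ b => f (cond b Γ'.bit1 Γ'.bit0))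
      ((Primrec.dom_finite fun b => f (cond b Γ'.bit1 Γ'.bit0)).comp Primrec.snd))
    (Primrec.const _)).to_comp

instance : Fintype K' :=
  ⟨{.main, .rev, .aux, .stack}, fun k => by cases k <;> simp⟩

/-- Take the function that runs the `n`-th partial recursive code on input `0`; deciding its domain
would solve the halting problem. -/
theorem exists_code_not_computable :
    ∃ c : ToPartrec.Code, ¬ ComputablePred fun n => (c.eval [n]).Dom := by
  have hf : Partrec fun n => (Denumerable.ofNat Nat.Partrec.Code n).eval 0 :=
    Nat.Partrec.Code.eval_part.comp (Computable.ofNat _) (Computable.const 0)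
  obtain ⟨c, hc⟩ := ToPartrec.Code.exists_code (Nat.Partrec'.part_iff₁.2 hf)
  refine ⟨c, fun h => ComputablePred.halting_problem 0 ?_⟩
  obtain ⟨g, hg, e⟩ := ComputablePred.computable_iff.1 h
  refine ComputablePred.computable_iff.2 ⟨_, hg.comp Computable.encode, funext fun d => ?_⟩
  rw [← congrFun e]
  have := hc ⟨[Encodable.encode d], rfl⟩
  simp only at this
  rw [this]
  simp [List.Vector.head]

/-- The program `tr`, with its type unfolded. -/
def program : Λ' → TM2.Stmt (fun _ : K' => Γ') Λ' (Option Γ') := tr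

theorem accepts_program_iff (c : ToPartrec.Code) (n : ℕ) :
    (stmtMachine program none).Accepts (.halt, none)
        ((program (trNormal c .halt), none), K'.elim (trList [n]) [] [] []) ↔
      (c.eval [n]).Dom :=
  (stmtMachine_accepts_iff program none (trNormal c .halt) none _).trans
    (iff_of_eq (congrArg Part.Dom (tr_eval c [n])))

end Turing.PartrecToTM2

/-! ### Conclusion -/

open Turing Turing.PartrecToTM2 in
theorem undecidable_of_syncEmpty_of_syncArb {P : FinDPDA → Prop}
    (hempty : ∀ M w, M.machine.SyncEmpty w → P M)
    (harb : ∀ M, P M → ∃ w, M.machine.SyncArb w) : FinDPDA.Undecidable P := by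
  classical
  obtain ⟨c, hc⟩ := exists_code_not_computable
  let _ : Inhabited Λ' := ⟨trNormal c .halt⟩
  have hL : TM2.Supports program (codeSupp c .halt) := tr_supports c .halt
  -- The type of all statements is infinite; those supported by `c`, with `halt` and the values of
  -- the variable, form a finite set closed under steps.
  let T : Finset (TM2.Stmt (fun _ : K' => Γ') Λ' (Option Γ') × Option Γ') :=
    insert .halt (TM2.stmts program (codeSupp c .halt)).eraseNone ×ˢ Finset.univ
  have hT (s) : s ∈ T ↔ s.1 = .halt ∨ some s.1 ∈ TM2.stmts program (codeSupp c .halt) := by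
    simp [T]
  let N := (stmtMachine program none).restrict T fun s hs t =>
    (hT _).2 (stmtMachine_step_mem hL none s ((hT s).1 hs) t)
  let ini (n : ℕ) : K' → List Γ' := K'.elim (trList [n]) [] [] []
  refine N.undecidable_of_accepts ⟨(.halt, none), (hT _).2 (.inl rfl)⟩
    ⟨(program (trNormal c .halt), none), (hT _).2 (.inr (TM2.some_mem_stmts hL.1))⟩ ini ?_ ?_
    hempty harb
  · rintro (_ | _ | _ | _) f
    · exact computable_map_trList_singleton f
    all_goals exact Computable.const _
  · refine fun hN => hc (hN.of_eq fun n => ?_)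
    rw [MultiStack.restrict_accepts_iff]
    exact accepts_program_iff c n

theorem mainTheorem10 :
    FinDPDA.Undecidable SyncDPDAEmpty ∧
    FinDPDA.Undecidable SyncDPDASame ∧
    FinDPDA.Undecidable SyncDPDAArb :=
  ⟨undecidable_of_syncEmpty_of_syncArb (fun _ w hw => ⟨w, hw⟩)
      fun _ ⟨w, hw⟩ => ⟨w, hw.syncSame.syncArb⟩,
    undecidable_of_syncEmpty_of_syncArb (fun _ w hw => ⟨w, hw.syncSame⟩)
      fun _ ⟨w, hw⟩ => ⟨w, hw.syncArb⟩,
    undecidable_of_syncEmpty_of_syncArb (fun _ w hw => ⟨w, hw.syncSame.syncArb⟩)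
      fun _ ⟨w, hw⟩ => ⟨w, hw⟩⟩
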